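/- Let $k \ge 2$ be a fixed integer and let $\mathcal{D}$ be a fixed non-atomic probability distribution on $\mathbb{R}$ (no single point has positive probability) whose support is contained in $[0,1]$. For every positive integer $n$ divisible by $k$, let $m = m(n)$ be a natural number. Consider a set $N$ of $n$ agents and a set $M$ of $m$ goods, where the values $u_a(g)$, for $a \in N$ and $g \in M$, are drawn independently from $\mathcal{D}$ and utilities are additive: $u_a(S) = \sum_{g \in S} u_a(g)$ for $S \subseteq M$. An outcome consists of an ordered partition $(C_1,\dots,C_k)$ of $N$ into $k$ groups of equal size $|C_i| = n/k$ and an ordered partition $(A_1,\dots,A_k)$ of $M$ into $k$ (possibly empty) bundles; it is envy-free if $u_a(A_i) \ge u_a(A_j)$ for all $i,j \in \{1,\dots,k\}$ and all $a \in C_i$. If $m = o(\sqrt{n})$ and $m$ is not divisible by $k$ for all sufficiently large $n$, then, as $n \to \infty$ along the multiples of $k$, the probability that no envy-free outcome exists tends to $1$. -/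

import Mathlib

open Filter MeasureTheory Topology Asymptotics

/-- An outcome of the variable-group model with agents `Fin n`, goods `Fin m` and desired group
sizes `s 0, …, s (k-1)`: an ordered partition of the agents into groups `C i` of size `s i`,
together with a complete allocation of the goods, bundle `A i` going to group `C i`. -/
structure Outcome {k : ℕ} (n m : ℕ) (s : Fin k → ℕ) where
  /-- The groups of agents. -/
  C : Fin k → Finset (Fin n)
  /-- The bundles of goods. -/
  A : Fin k → Finset (Fin m)
  groups_disjoint : ∀ i j, i ≠ j → Disjoint (C i) (C j)
  groups_cover : ∀ a, ∃ i, a ∈ C i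
  groups_card : ∀ i, (C i).card = s i
  bundles_disjoint : ∀ i j, i ≠ j → Disjoint (A i) (A j)
  bundles_cover : ∀ g, ∃ i, g ∈ A i

namespace Outcome

variable {k n m : ℕ} {s : Fin k → ℕ}

/-- Envy-freeness up to `c` goods, where `u a S` is the utility of agent `a` for the set `S`. -/
def IsEFUpTo (o : Outcome n m s) (u : Fin n → Finset (Fin m) → ℝ) (c : ℕ) : Prop :=
  ∀ i j, ∀ a ∈ o.C i, ∃ B ⊆ o.A j, B.card ≤ c ∧ u a (o.A j \ B) ≤ u a (o.A i)

/-- An outcome is envy-free if it is envy-free up to zero goods. -/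
def IsEnvyFree (o : Outcome n m s) (u : Fin n → Finset (Fin m) → ℝ) : Prop :=
  o.IsEFUpTo u 0

end Outcome

/-- The additive utilities determined by the values `v a g` of agent `a` for the single good `g`. -/
def additiveUtility {n m : ℕ} (v : Fin n → Fin m → ℝ) : Fin n → Finset (Fin m) → ℝ :=
  fun a S => ∑ g ∈ S, v a g

/-- The joint law of the values `v a g` when they are drawn independently from `D`. -/
noncomputable def valueLaw (D : Measure ℝ) (n m : ℕ) : Measure (Fin n → Fin m → ℝ) :=
  Measure.pi fun _ => Measure.pi fun _ => D

/-- The limit `n → ∞` along the multiples of `k`. -/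
def atTopMultiples (k : ℕ) : Filter ℕ := atTop ⊓ 𝓟 {n | k ∣ n}

/-- The event that there is no envy-free outcome with `k` groups of equal size `n / k`
(used only when `k` divides `n`). -/
def noEnvyFreeOutcome (k n m : ℕ) : Set (Fin n → Fin m → ℝ) :=
  {v | ¬ ∃ o : Outcome n m (fun _ : Fin k => n / k), o.IsEnvyFree (additiveUtility v)}

open ProbabilityTheory

/-! Fix an allocation. As k does not divide m, some smallest bundle `A i₀` is strictly smaller than
another bundle `A j₀`, and in an envy-free outcome n/k agents have `A i₀` as a favourite. A single
agent does so with probability at most 1/k - c/√m (`exists_measureReal_favourite_le`). By Hoeffding,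
n/k such agents occur with probability at most exp(-2nc²/m), and a union bound over the k^m
allocations gives k^m exp(-2nc²/m), which tends to 0 because m² = o(n). The groups need no union
bound: only the number of such agents matters.

For the gap, trim each bundle to s = |`A i₀`| goods. If s > 0, the trimmed values are i.i.d. without
atoms, so `A i₀` wins among them with probability at most 1/k. That win is spoiled when its lead
over the trimmed `A j₀` is below δ and a discarded good of `A j₀` is worth at least δ; the good is
independent of the trimmed values. A sum of s values fluctuates on a scale of at most √s, so a win
with so narrow a lead has probability at least of order 1/√s
(`exists_le_measureReal_pi_isMax_inter_lt`): cut a range above the median into about √s bins of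
width δ, and let i₀ and j₀ share a bin while the others stay below the median. -/

/-! ### Medians, bins and ties on the line -/

/-- Every probability measure on the line has a median. -/
theorem exists_median (ν : Measure ℝ) [IsProbabilityMeasure ν] :
    ∃ t, 1 / 2 ≤ ν.real (Set.Iic t) ∧ 1 / 2 ≤ ν.real (Set.Ici t) := by
  set S : Set ℝ := {x | 1 / 2 ≤ cdf ν x} with hS
  have hne : S.Nonempty :=
    ((tendsto_cdf_atTop ν).eventually (eventually_ge_nhds (by norm_num : (1 / 2 : ℝ) < 1))).exists
  obtain ⟨y, hy⟩ :=
    ((tendsto_cdf_atBot ν).eventually (eventually_lt_nhds (by norm_num : (0 : ℝ) < 1 / 2))).exists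
  have hbdd : BddBelow S := ⟨y, fun x hx => by
    by_contra h
    exact absurd ((monotone_cdf ν) (not_le.1 h).le) (not_le.2 (hy.trans_le hx))⟩
  -- Right continuity of the cdf gives the first bound; points below the infimum have cdf less than
  -- 1/2, which gives the second.
  refine ⟨sInf S, ?_, ?_⟩
  · rw [← cdf_eq_real]
    have hc : Tendsto (cdf ν) (𝓝[>] (sInf S)) (𝓝 (cdf ν (sInf S))) :=
      ((cdf ν).right_continuous _).mono Set.Ioi_subset_Ici_self
    refine ge_of_tendsto hc ?_
    filter_upwards [self_mem_nhdsWithin] with x hx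
    obtain ⟨z, hz, hzx⟩ := exists_lt_of_csInf_lt hne hx
    exact hz.trans (monotone_cdf ν hzx.le)
  · have h1 : Tendsto (fun n : ℕ => ν (Set.Iic (sInf S - 1 / ((n : ℝ) + 1)))) atTop
        (𝓝 (ν (⋃ n : ℕ, Set.Iic (sInf S - 1 / ((n : ℝ) + 1))))) := by
      refine tendsto_measure_iUnion_atTop fun a b hab => Set.Iic_subset_Iic.2 ?_
      have : 1 / ((b : ℝ) + 1) ≤ 1 / ((a : ℝ) + 1) :=
        one_div_le_one_div_of_le (by positivity) (by gcongr)
      linarith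
    have h2 : (⋃ n : ℕ, Set.Iic (sInf S - 1 / ((n : ℝ) + 1))) = Set.Iio (sInf S) := by
      ext x
      simp only [Set.mem_iUnion, Set.mem_Iic, Set.mem_Iio]
      constructor
      · rintro ⟨n, hn⟩
        have : 0 < 1 / ((n : ℝ) + 1) := by positivity
        linarith
      · intro hx
        obtain ⟨n, hn⟩ := exists_nat_one_div_lt (sub_pos.2 hx)
        exact ⟨n, by linarith⟩
    have h3 : ν.real (Set.Iio (sInf S)) ≤ 1 / 2 := by
      rw [h2] at h1
      have h4 := (ENNReal.tendsto_toReal (measure_ne_top ν _)).comp h1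
      refine le_of_tendsto h4 (Eventually.of_forall fun n => ?_)
      have h5 : sInf S - 1 / ((n : ℝ) + 1) ∉ S := notMem_of_lt_csInf (by
        have : 0 < 1 / ((n : ℝ) + 1) := by positivity
        linarith) hbdd
      rw [hS, Set.mem_ofPred_eq, not_le, cdf_eq_real] at h5
      exact h5.le
    have h6 := probReal_compl_eq_one_sub (μ := ν) (s := Set.Iio (sInf S)) measurableSet_Iio
    rw [Set.compl_Iio] at h6
    linarith

theorem sum_measureReal_Ico_add_mul (ν : Measure ℝ) [IsFiniteMeasure ν] (t δ : ℝ) (hδ : 0 ≤ δ)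
    (q : ℕ) :
    ∑ b ∈ Finset.range q, ν.real (Set.Ico (t + b * δ) (t + (b + 1) * δ)) =
      ν.real (Set.Ico t (t + q * δ)) := by
  induction q with
  | zero => simp
  | succ q ih =>
    rw [Finset.sum_range_succ, ih, ← measureReal_union _ measurableSet_Ico]
    · rw [Set.Ico_union_Ico_eq_Ico]
      · push_cast; rfl
      · have : 0 ≤ (q : ℝ) * δ := by positivity
        linarith
      · nlinarith
    · exact Set.disjoint_left.2 fun x hx hx' => absurd hx.2 (not_lt.2 hx'.1)

/-- Cauchy–Schwarz. The sum of squares is the probability that two independent copies fall into the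
same bin. -/
theorem sq_measureReal_Ico_le_card_mul_sum (ν : Measure ℝ) [IsFiniteMeasure ν] (t δ : ℝ)
    (hδ : 0 ≤ δ) (q : ℕ) :
    ν.real (Set.Ico t (t + q * δ)) ^ 2 ≤
      q * ∑ b ∈ Finset.range q, ν.real (Set.Ico (t + b * δ) (t + (b + 1) * δ)) ^ 2 := by
  rw [← sum_measureReal_Ico_add_mul ν t δ hδ]
  simpa using sq_sum_le_card_mul_sum_sq (s := Finset.range q)
    (f := fun b : ℕ => ν.real (Set.Ico (t + b * δ) (t + (b + 1) * δ)))

theorem pairwise_disjoint_Ico_add_mul (t δ : ℝ) (hδ : 0 ≤ δ) :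
    Pairwise fun a b : ℕ => Disjoint (Set.Ico (t + a * δ) (t + (a + 1) * δ))
      (Set.Ico (t + b * δ) (t + (b + 1) * δ)) := by
  have key : ∀ a b : ℕ, a < b → Disjoint (Set.Ico (t + a * δ) (t + (a + 1) * δ))
      (Set.Ico (t + b * δ) (t + (b + 1) * δ)) := fun a b hab => by
    refine Set.disjoint_left.2 fun x hx hx' => absurd hx.2 (not_lt.2 (le_trans ?_ hx'.1))
    have : (a : ℝ) + 1 ≤ b := by exact_mod_cast hab
    gcongr
  intro a b hab
  rcases hab.lt_or_gt with h | h
  · exact key a b h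
  · exact (key b a h).symm

/-- A random variable whose law has no atoms almost surely differs from an independent one. -/
theorem ProbabilityTheory.IndepFun.measure_eq_eq_zero {Ω : Type*} {_ : MeasurableSpace Ω}
    {μ : Measure Ω} [IsProbabilityMeasure μ] {X Y : Ω → ℝ} (h : IndepFun X Y μ)
    (hX : Measurable X) (hY : Measurable Y) (h0 : ∀ c, μ {ω | X ω = c} = 0) :
    μ {ω | X ω = Y ω} = 0 := by
  have h1 := (indepFun_iff_map_prod_eq_prod_map_map hX.aemeasurable hY.aemeasurable).1 h
  have := Measure.isProbabilityMeasure_map (μ := μ) hX.aemeasurable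
  have := Measure.isProbabilityMeasure_map (μ := μ) hY.aemeasurable
  have hm : MeasurableSet {p : ℝ × ℝ | p.1 = p.2} :=
    measurableSet_eq_fun measurable_fst measurable_snd
  have h2 : μ {ω | X ω = Y ω} = μ.map (fun ω => (X ω, Y ω)) {p : ℝ × ℝ | p.1 = p.2} := by
    rw [Measure.map_apply (hX.prodMk hY) hm]; rfl
  rw [h2, h1, Measure.prod_apply_symm hm]
  refine (lintegral_congr fun y => ?_).trans (lintegral_zero)
  rw [Measure.map_apply hX (measurable_prodMk_right hm)]
  exact h0 y

/-! ### The maximum of i.i.d. variables -/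

section IID

variable {k : ℕ} (ν : Measure ℝ) [IsProbabilityMeasure ν]

theorem measureReal_pi_comp_swap (i j : Fin k) {S : Set (Fin k → ℝ)} (hS : MeasurableSet S) :
    (Measure.pi fun _ : Fin k => ν).real ((fun x => x ∘ Equiv.swap i j) ⁻¹' S) =
      (Measure.pi fun _ : Fin k => ν).real S := by
  have h : MeasurePreserving (fun x : Fin k → ℝ => x ∘ Equiv.swap i j)
      (Measure.pi fun _ => ν) (Measure.pi fun _ => ν) := by
    refine ⟨by fun_prop, ?_⟩
    have := (iIndepFun_pi (μ := fun _ : Fin k => ν) (X := fun _ x => x)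
      (fun _ => aemeasurable_id)).precomp (Equiv.swap i j).injective
    rw [iIndepFun_iff_map_fun_eq_pi_map (fun _ => (measurable_pi_apply _).aemeasurable)] at this
    refine this.trans ?_
    congr 1
    ext1 a
    exact (measurePreserving_eval (fun _ : Fin k => ν) _).map_eq
  exact congrArg ENNReal.toReal (h.measure_preimage hS.nullMeasurableSet)

theorem measurableSet_forall_le_apply (i : Fin k) :
    MeasurableSet {x : Fin k → ℝ | ∀ j, x j ≤ x i} := by
  have : {x : Fin k → ℝ | ∀ j, x j ≤ x i} = ⋂ j, {x | x j ≤ x i} := by ext; simp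
  rw [this]
  exact MeasurableSet.iInter fun j => measurableSet_le (by fun_prop) (by fun_prop)

/-- By exchangeability the k events are equally likely, and without atoms they are almost surely
disjoint. -/
theorem measureReal_pi_isMax_le [NullSingletonClass ν] (i : Fin k) :
    (Measure.pi fun _ : Fin k => ν).real {x | ∀ j, x j ≤ x i} ≤ 1 / k := by
  set P := Measure.pi fun _ : Fin k => ν
  have hswap : ∀ l, P.real {x | ∀ j, x j ≤ x l} = P.real {x | ∀ j, x j ≤ x i} := fun l => by
    rw [← measureReal_pi_comp_swap ν i l (measurableSet_forall_le_apply i)]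
    congr 1
    ext x
    simp only [Set.mem_ofPred_eq, Set.mem_preimage, Function.comp, Equiv.swap_apply_left]
    exact ⟨fun h j => h _, fun h j => by simpa using h (Equiv.swap i l j)⟩
  have hdisj : Pairwise (Function.onFun (AEDisjoint P) fun l => {x : Fin k → ℝ | ∀ j, x j ≤ x l}) := by
    intro a b hab
    have hind := (iIndepFun_pi (μ := fun _ : Fin k => ν) (X := fun _ x => x)
      (fun _ => aemeasurable_id)).indepFun hab
    refine measure_mono_null ?_ (hind.measure_eq_eq_zero (by fun_prop) (by fun_prop) fun c => ?_)
    · exact fun x hx => le_antisymm (hx.2 a) (hx.1 b)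
    · exact Measure.pi_hyperplane (fun _ : Fin k => ν) a c
  have hsum : ∑ l, P.real {x | ∀ j, x j ≤ x l} ≤ 1 := by
    have h1 := measure_iUnion₀ hdisj fun l => (measurableSet_forall_le_apply l).nullMeasurableSet
    rw [tsum_fintype] at h1
    have h2 : ∑ l, P {x | ∀ j, x j ≤ x l} ≤ 1 := h1 ▸ prob_le_one
    simp only [Measure.real]
    rw [← ENNReal.toReal_sum fun _ _ => measure_ne_top _ _]
    exact ENNReal.toReal_le_of_le_ofReal zero_le_one (by simpa using h2)
  simp only [hswap, Finset.sum_const, Finset.card_univ, Fintype.card_fin, nsmul_eq_mul] at hsum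
  have : (0 : ℝ) < k := by exact_mod_cast i.pos
  rw [le_div_iff₀ this]
  linarith

/-- Lower bound for the probability that, among `k` independent copies of a real random variable,
the copy `i` is the largest and exceeds the copy `j` by less than `δ`. -/
theorem le_measureReal_pi_isMax_inter_lt {i j : Fin k} (hij : i ≠ j) {t δ : ℝ} (hδ : 0 ≤ δ)
    (ht : 1 / 2 ≤ ν.real (Set.Iic t)) (q : ℕ) :
    (1 / 2) ^ (k + 1) * ∑ b ∈ Finset.range q, ν.real (Set.Ico (t + b * δ) (t + (b + 1) * δ)) ^ 2 ≤
      (Measure.pi fun _ : Fin k => ν).real {x | (∀ l, x l ≤ x i) ∧ x i < x j + δ} := by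
  set P := Measure.pi fun _ : Fin k => ν
  set I : ℕ → Set ℝ := fun b => Set.Ico (t + b * δ) (t + (b + 1) * δ) with hI
  set J : Fin k → Fin k → Set (Fin k → ℝ) := fun i j => {x | (∀ l, x l ≤ x i) ∧ x i < x j + δ}
    with hJ
  have hJm : MeasurableSet (J i j) :=
    (measurableSet_forall_le_apply i).inter (measurableSet_lt (f := fun x : Fin k → ℝ => x i)
      (g := fun x => x j + δ) (by fun_prop) (by fun_prop))
  have hswap : P.real (J j i) = P.real (J i j) := by
    rw [← measureReal_pi_comp_swap ν i j hJm]
    congr 1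
    ext x
    simp only [hJ, Set.mem_ofPred_eq, Set.mem_preimage, Function.comp, Equiv.swap_apply_left,
      Equiv.swap_apply_right]
    exact and_congr_left fun _ =>
      ⟨fun h l => h _, fun h l => by simpa using h (Equiv.swap i j l)⟩
  -- Boxes in which i and j share bin b and all other coordinates stay below t, hence below the bin.
  -- The maximum is then at i or j, and these two cases are exchanged by the swap; this costs the
  -- extra factor 1/2.
  set s : ℕ → Fin k → Set ℝ := fun b l => if l = i ∨ l = j then I b else Set.Iic t with hs
  have hsi : ∀ b, s b i = I b := fun b => by simp [hs]
  have hsj : ∀ b, s b j = I b := fun b => by simp [hs]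
  have hsm : ∀ b, MeasurableSet (Set.univ.pi (s b)) := fun b =>
    MeasurableSet.univ_pi fun l => by
      simp only [hs]; split_ifs
      exacts [measurableSet_Ico, measurableSet_Iic]
  have hRP : ∀ b, (1 / 2) ^ k * ν.real (I b) ^ 2 ≤ P.real (Set.univ.pi (s b)) := fun b => by
    have h1 : P.real (Set.univ.pi (s b)) = ∏ l, ν.real (s b l) := by
      simp only [Measure.real, P, Measure.pi_pi, ENNReal.toReal_prod]
    have h2 : ∏ l, ((1 / 2 : ℝ) * if l ∈ ({i, j} : Finset (Fin k)) then ν.real (I b) else 1) ≤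
        ∏ l, ν.real (s b l) := by
      refine Finset.prod_le_prod (fun l _ => by positivity) fun l _ => ?_
      simp only [hs, Finset.mem_insert, Finset.mem_singleton]
      split_ifs
      · linarith [measureReal_nonneg (μ := ν) (s := I b)]
      · linarith
    rw [Finset.prod_mul_distrib, Finset.prod_ite_mem, Finset.univ_inter, Finset.prod_pair hij,
      Finset.prod_const, Finset.card_univ, Fintype.card_fin, ← sq] at h2
    exact h1 ▸ h2
  have hdisj : Set.PairwiseDisjoint (Finset.range q : Set ℕ) fun b => Set.univ.pi (s b) := by
    intro a _ b _ hab
    refine Set.disjoint_left.2 fun x hx hx' => ?_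
    exact Set.disjoint_left.1 (pairwise_disjoint_Ico_add_mul t δ hδ hab)
      (hsi a ▸ hx i trivial : x i ∈ I a) (hsi b ▸ hx' i trivial : x i ∈ I b)
  have hsub : (⋃ b ∈ Finset.range q, Set.univ.pi (s b)) ⊆ J i j ∪ J j i := by
    intro x hx
    simp only [Set.mem_iUnion] at hx
    obtain ⟨b, -, hx⟩ := hx
    have hi : x i ∈ I b := hsi b ▸ hx i trivial
    have hj : x j ∈ I b := hsj b ▸ hx j trivial
    simp only [hI, Set.mem_Ico] at hi hj
    have hb : 0 ≤ (b : ℝ) * δ := by positivity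
    have hl : ∀ l, l ≠ i → l ≠ j → x l ≤ t := fun l h1 h2 => by
      have := hx l trivial
      simpa [hs, h1, h2] using this
    rcases le_total (x j) (x i) with h | h
    · refine Or.inl ⟨fun l => ?_, by linarith⟩
      by_cases h1 : l = i
      · rw [h1]
      by_cases h2 : l = j
      · rwa [h2]
      linarith [hl l h1 h2]
    · refine Or.inr ⟨fun l => ?_, by linarith⟩
      by_cases h1 : l = i
      · rwa [h1]
      by_cases h2 : l = j
      · rw [h2]
      linarith [hl l h1 h2]
  have h1 := (measureReal_mono hsub (measure_ne_top P _)).trans (measureReal_union_le _ _)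
  rw [measureReal_biUnion_finset hdisj fun b _ => hsm b, hswap] at h1
  have h2 := Finset.sum_le_sum fun b (_ : b ∈ Finset.range q) => hRP b
  rw [← Finset.mul_sum] at h2
  rw [pow_succ]
  linarith

end IID

/-! ### Sums of i.i.d. values -/

/-- The law of the sum of `s` independent variables with law `D`. -/
noncomputable def sumLaw (D : Measure ℝ) (s : ℕ) : Measure ℝ :=
  (Measure.pi fun _ : Fin s => D).map fun w => ∑ i, w i

section SumLaw

variable (D : Measure ℝ) [IsProbabilityMeasure D]

instance (s : ℕ) : IsProbabilityMeasure (sumLaw D s) :=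
  Measure.isProbabilityMeasure_map (by fun_prop)

theorem iIndepFun_apply_pi (ι : Type*) [Fintype ι] :
    iIndepFun (fun (i : ι) (w : ι → ℝ) => w i) (Measure.pi fun _ => D) :=
  iIndepFun_pi (μ := fun _ => D) (X := fun _ x => x) fun _ => aemeasurable_id

theorem map_pi_comp_injective {ι κ : Type*} [Fintype ι] [Fintype κ] {e : κ → ι}
    (he : e.Injective) :
    (Measure.pi fun _ : ι => D).map (fun w => fun i => w (e i)) = Measure.pi fun _ : κ => D := by
  have := (iIndepFun_apply_pi D ι).precomp he
  rw [iIndepFun_iff_map_fun_eq_pi_map (fun _ => (measurable_pi_apply _).aemeasurable)] at this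
  refine this.trans ?_
  congr 1
  ext1 a
  exact (measurePreserving_eval (fun _ : ι => D) _).map_eq

theorem map_pi_pi_uncurry (ι κ : Type*) [Fintype ι] [Fintype κ] :
    (Measure.pi fun _ : ι => Measure.pi fun _ : κ => D).map (fun x (p : ι × κ) => x p.1 p.2) =
      Measure.pi fun _ : ι × κ => D := by
  refine (Measure.pi_eq fun s hs => ?_).symm
  have hm : Measurable fun (x : ι → κ → ℝ) (p : ι × κ) => x p.1 p.2 := by fun_prop
  rw [Measure.map_apply hm (MeasurableSet.univ_pi hs)]
  have : (fun (x : ι → κ → ℝ) (p : ι × κ) => x p.1 p.2) ⁻¹' Set.univ.pi s =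
      Set.univ.pi fun i => Set.univ.pi fun l => s (i, l) := by
    ext x; simp [Set.mem_pi]
  rw [this, Measure.pi_pi, Fintype.prod_prod_type]
  simp [Measure.pi_pi]

theorem map_pi_sum_of_injective {k s m : ℕ} {e : Fin k × Fin s → Fin m} (he : e.Injective) :
    (Measure.pi fun _ : Fin m => D).map (fun w j => ∑ i, w (e (j, i))) =
      Measure.pi fun _ : Fin k => sumLaw D s := by
  have h1 : (fun (w : Fin m → ℝ) j => ∑ i, w (e (j, i))) =
      (fun (y : Fin k × Fin s → ℝ) j => ∑ i, y (j, i)) ∘ fun w => fun p => w (e p) := rfl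
  rw [h1, ← Measure.map_map (by fun_prop) (by fun_prop), map_pi_comp_injective D he,
    ← map_pi_pi_uncurry, Measure.map_map (by fun_prop) (by fun_prop)]
  exact Measure.pi_map_pi (μ := fun _ : Fin k => Measure.pi fun _ : Fin s => D)
    (f := fun _ y => ∑ i, y i) fun _ => by fun_prop

/-- One summand is atomless and independent of c minus the rest. At least one summand is needed: the
empty sum has an atom at 0. -/
theorem sumLaw_succ_nullSingletonClass [NullSingletonClass D] (s : ℕ) :
    NullSingletonClass (sumLaw D (s + 1)) where
  measure_singleton c := by
    rw [sumLaw, Measure.map_apply (by fun_prop) (measurableSet_singleton c)]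
    have h := ((iIndepFun_apply_pi D (Fin (s + 1))).indepFun_finsetSum_of_notMem
      (fun _ => by fun_prop) (s := Finset.univ.erase 0) (i := 0) (by simp)).symm
    have h' := h.comp measurable_id (measurable_const_sub c)
    refine measure_mono_null ?_ (h'.measure_eq_eq_zero (measurable_pi_apply _) ?_ fun d => ?_)
    · intro w hw
      have hw : ∑ i, w i = c := hw
      rw [← Finset.add_sum_erase _ _ (Finset.mem_univ 0)] at hw
      simp only [Set.mem_ofPred_eq, Function.comp, id, Finset.sum_apply]
      linarith
    · rw [Finset.sum_fn]
      fun_prop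
    · exact Measure.pi_hyperplane (fun _ : Fin (s + 1) => D) 0 d

/-- Chebyshev around the mean, with the crude variance bound 1 per summand. -/
theorem measureReal_sumLaw_two_mul_sqrt_le (hD : ∀ᵐ x ∂D, x ∈ Set.Icc (0 : ℝ) 1) {s : ℕ}
    (hs : 0 < s) : ∃ a, (sumLaw D s).real {x | 2 * √s ≤ |x - a|} ≤ 1 / 4 := by
  set P := Measure.pi fun _ : Fin s => D
  have hmem : ∀ _ : Fin s, MemLp (fun x : ℝ => x) 2 D := fun _ =>
    memLp_of_bounded hD aestronglyMeasurable_id 2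
  have hvar : Var[∑ i, fun w : Fin s → ℝ => w i; P] ≤ s := by
    rw [variance_sum_pi (X := fun _ x => x) hmem]
    have : ∀ i ∈ (Finset.univ : Finset (Fin s)), Var[fun x : ℝ => x; D] ≤ 1 := fun _ _ =>
      (variance_le_sq_of_bounded hD aemeasurable_id).trans (by norm_num)
    simpa using Finset.sum_le_sum this
  have hL : MemLp (∑ i, fun w : Fin s → ℝ => w i) 2 P := memLp_finsetSum' _ fun i _ =>
    (hmem i).comp_measurePreserving (measurePreserving_eval (fun _ => D) i)
  have hpos : 0 < 2 * √(s : ℝ) := by positivity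
  refine ⟨P[∑ i, fun w : Fin s → ℝ => w i], ?_⟩
  have h := meas_ge_le_variance_div_sq hL hpos
  have hle : Var[∑ i, fun w : Fin s → ℝ => w i; P] / (2 * √s) ^ 2 ≤ 1 / 4 := by
    rw [mul_pow, Real.sq_sqrt (by positivity), div_le_div_iff₀ (by positivity) (by norm_num)]
    linarith
  have hm : MeasurableSet {x : ℝ | 2 * √s ≤ |x - P[∑ i, fun w : Fin s → ℝ => w i]|} :=
    measurableSet_le measurable_const (by fun_prop)
  refine ENNReal.toReal_le_of_le_ofReal (by norm_num) ?_
  rw [sumLaw, Measure.map_apply (by fun_prop) hm]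
  refine le_trans (le_of_eq ?_) (h.trans (ENNReal.ofReal_le_ofReal hle))
  congr 1
  ext w
  simp

end SumLaw

/-! ### The gap below 1/k for a smallest bundle -/

/-- For `k` independent copies of a variable that lies in an interval of length `2 r` with
probability at least `3 / 4`, with probability of order `δ / r` a given copy is the largest and
exceeds another given copy by less than `δ`. -/
theorem exists_le_measureReal_pi_isMax_inter_lt {k : ℕ} (ν : Measure ℝ) [IsProbabilityMeasure ν]
    {i j : Fin k} (hij : i ≠ j) {a r δ : ℝ} (hδ : 0 < δ)
    (hr : ν.real {x | r ≤ |x - a|} ≤ 1 / 4) {q : ℕ} (hq0 : 0 < q) (hq : 2 * r ≤ q * δ) :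
    (1 / 2) ^ (k + 1) * (1 / 16 / q) ≤
      (Measure.pi fun _ : Fin k => ν).real {x | (∀ l, x l ≤ x i) ∧ x i < x j + δ} := by
  obtain ⟨t, ht1, ht2⟩ := exists_median ν
  have hta : a - r ≤ t := by
    by_contra! h
    have : ν.real (Set.Iic t) ≤ ν.real {x | r ≤ |x - a|} := measureReal_mono (fun x hx => by
      simp only [Set.mem_Iic, Set.mem_ofPred_eq] at hx ⊢
      rw [le_abs]; right; linarith)
    linarith
  -- Since t ≥ a - r and qδ ≥ 2r, the bins reach a + r; of the mass 1/2 above t, at most 1/4 is lost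
  -- in the tail.
  have h1 : 1 / 4 ≤ ν.real (Set.Ico t (t + q * δ)) := by
    have h2 : Set.Ici t ⊆ Set.Ico t (t + q * δ) ∪ {x | r ≤ |x - a|} := fun x hx => by
      rcases lt_or_ge x (t + q * δ) with h | h
      · exact Or.inl ⟨hx, h⟩
      · right
        simp only [Set.mem_ofPred_eq]
        rw [le_abs]; left; linarith
    have h3 := (measureReal_mono (μ := ν) h2).trans (measureReal_union_le _ _)
    linarith
  refine le_trans ?_ (le_measureReal_pi_isMax_inter_lt ν hij hδ.le ht1 q)
  have h4 := sq_measureReal_Ico_le_card_mul_sum ν t δ hδ.le q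
  have hq' : (0 : ℝ) < q := by exact_mod_cast hq0
  gcongr
  rw [div_le_iff₀ hq']
  nlinarith

/-- Otherwise D would be concentrated at 0, an atom. -/
theorem exists_pos_measureReal_Ici_pos (D : Measure ℝ) [IsProbabilityMeasure D]
    [NullSingletonClass D] (hD : ∀ᵐ x ∂D, x ∈ Set.Icc (0 : ℝ) 1) :
    ∃ δ > 0, 0 < D.real (Set.Ici δ) := by
  by_contra! h
  have h0 : ∀ n : ℕ, D (Set.Ici (1 / ((n : ℝ) + 1))) = 0 := fun n => by
    have := le_antisymm (h (1 / ((n : ℝ) + 1)) (by positivity)) measureReal_nonneg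
    rwa [measureReal_eq_zero_iff] at this
  have h1 : ∀ᵐ x ∂D, ∀ n : ℕ, x ∉ Set.Ici (1 / ((n : ℝ) + 1)) :=
    ae_all_iff.2 fun n => measure_eq_zero_iff_ae_notMem.1 (h0 n)
  have h2 : ∀ᵐ x ∂D, x ≠ 0 := by simp [ae_iff]
  obtain ⟨x, hx, hx1, hx2⟩ := (hD.and (h1.and h2)).exists
  obtain ⟨n, hn⟩ := exists_nat_one_div_lt (lt_of_le_of_ne hx.1 hx2.symm)
  exact hx1 n hn.le

theorem indepFun_sum_finset_apply (D : Measure ℝ) [IsProbabilityMeasure D] {k m : ℕ}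
    (B : Fin k → Finset (Fin m)) {g : Fin m} (hg : ∀ j, g ∉ B j) :
    IndepFun (fun (w : Fin m → ℝ) j => ∑ l ∈ B j, w l) (fun w => w g)
      (Measure.pi fun _ : Fin m => D) := by
  have h := (iIndepFun_apply_pi D (Fin m)).indepFun_finset {g}ᶜ {g}
    (Finset.disjoint_left.2 fun x h1 h2 => Finset.mem_compl.1 h1 h2) fun _ => by fun_prop
  have hφ : Measurable fun (y : ({g}ᶜ : Finset (Fin m)) → ℝ) (j : Fin k) =>
      ∑ l : ({g}ᶜ : Finset (Fin m)), if (l : Fin m) ∈ B j then y l else 0 := by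
    refine measurable_pi_lambda _ fun j => Finset.measurable_sum _ fun l _ => ?_
    split_ifs <;> fun_prop
  have hψ : Measurable fun (y : ({g} : Finset (Fin m)) → ℝ) => y ⟨g, by simp⟩ := by fun_prop
  convert h.comp hφ hψ using 1
  swap
  · rfl
  ext w j
  simp only [Function.comp]
  rw [Finset.sum_coe_sort ({g}ᶜ : Finset (Fin m)) fun l => if l ∈ B j then w l else 0,
    Finset.sum_ite_mem]
  congr 1
  refine (Finset.inter_eq_right.2 fun l hl => ?_).symm
  simp only [Finset.mem_compl, Finset.mem_singleton]
  rintro rfl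
  exact hg j hl

theorem ae_pi_mem_Icc {D : Measure ℝ} [IsProbabilityMeasure D]
    (hD : ∀ᵐ x ∂D, x ∈ Set.Icc (0 : ℝ) 1) (m : ℕ) :
    ∀ᵐ w ∂(Measure.pi fun _ : Fin m => D), ∀ g, w g ∈ Set.Icc (0 : ℝ) 1 :=
  ae_all_iff.2 fun g => (measurePreserving_eval (fun _ : Fin m => D) g).quasiMeasurePreserving.ae hD

/-- The values of an agent for which the bundle `A i` is a favourite one. -/
def favourite {k m : ℕ} (A : Fin k → Finset (Fin m)) (i : Fin k) : Set (Fin m → ℝ) :=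
  {w | ∀ j, ∑ g ∈ A j, w g ≤ ∑ g ∈ A i, w g}

theorem measurableSet_favourite {k m : ℕ} (A : Fin k → Finset (Fin m)) (i : Fin k) :
    MeasurableSet (favourite A i) := by
  have : favourite A i = ⋂ j, {w | ∑ g ∈ A j, w g ≤ ∑ g ∈ A i, w g} := by
    ext; simp [favourite]
  rw [this]
  exact MeasurableSet.iInter fun j => measurableSet_le (by fun_prop) (by fun_prop)

/-- The trimming argument: being a favourite, and narrowly winning while the discarded good g is
worth at least δ, are almost surely disjoint events inside the event of winning among the trimmed
bundles. -/
theorem measureReal_favourite_le_of_pos {D : Measure ℝ} [IsProbabilityMeasure D]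
    [NullSingletonClass D] (hD : ∀ᵐ x ∂D, x ∈ Set.Icc (0 : ℝ) 1) {δ : ℝ} (hδ : 0 < δ) {k m : ℕ}
    (A : Fin k → Finset (Fin m)) (hA : ∀ i j, i ≠ j → Disjoint (A i) (A j)) {i₀ j₀ : Fin k}
    (hmin : ∀ j, (A i₀).card ≤ (A j).card) (hlt : (A i₀).card < (A j₀).card)
    (hpos : 0 < (A i₀).card) {q : ℕ} (hq0 : 0 < q) (hq : 4 * √(A i₀).card ≤ q * δ) :
    (Measure.pi fun _ : Fin m => D).real (favourite A i₀) ≤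
      1 / k - (1 / 2) ^ (k + 1) * (1 / 16 / q) * D.real (Set.Ici δ) := by
  set P := Measure.pi fun _ : Fin m => D
  set s := (A i₀).card with hs
  choose B hBA hBs using fun j => Finset.exists_subset_card_eq (hmin j)
  have hBi : B i₀ = A i₀ := Finset.eq_of_subset_of_card_le (hBA i₀) (hBs i₀).ge
  obtain ⟨g, hgA, hgB⟩ := Finset.exists_mem_notMem_of_card_lt_card
    (s := B j₀) (t := A j₀) (by rw [hBs]; exact hlt)
  have hg : ∀ j, g ∉ B j := fun j hj => by
    by_cases h : j = j₀
    · exact hgB (h ▸ hj)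
    · exact Finset.disjoint_left.1 (hA j j₀ h) (hBA j hj) hgA
  set X : (Fin m → ℝ) → Fin k → ℝ := fun w j => ∑ l ∈ B j, w l with hX
  have hXm : Measurable X := by fun_prop
  set e : Fin k × Fin s → Fin m := fun p => (B p.1).orderEmbOfFin (hBs p.1) p.2 with he
  have hinj : e.Injective := by
    rintro ⟨j, a⟩ ⟨l, b⟩ h
    have h1 : e (j, a) ∈ B j := Finset.orderEmbOfFin_mem _ _ _
    have h2 : e (l, b) ∈ B l := Finset.orderEmbOfFin_mem _ _ _
    have hjl : j = l := by
      by_contra hne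
      exact Finset.disjoint_left.1 (hA j l hne) (hBA j h1) (hBA l (h ▸ h2))
    subst hjl
    have : a = b := ((B j).orderEmbOfFin (hBs j)).injective h
    rw [this]
  have hXlaw : P.map X = Measure.pi fun _ : Fin k => sumLaw D s := by
    rw [← map_pi_sum_of_injective D hinj]
    congr 1
    ext w j
    simp only [hX, he]
    conv_lhs => rw [← Finset.map_orderEmbOfFin_univ (B j) (hBs j), Finset.sum_map]
    rfl
  have hXreal : ∀ S, MeasurableSet S →
      P.real (X ⁻¹' S) = (Measure.pi fun _ : Fin k => sumLaw D s).real S := fun S hS => by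
    rw [← hXlaw, map_measureReal_apply hXm hS]
  set F : Set (Fin k → ℝ) := {x | ∀ j, x j ≤ x i₀} with hF
  have hFm : MeasurableSet F := measurableSet_forall_le_apply i₀
  set J : Set (Fin k → ℝ) := {x | (∀ j, x j ≤ x i₀) ∧ x i₀ < x j₀ + δ} with hJ
  have hJm : MeasurableSet J := hFm.inter (measurableSet_lt (f := fun x : Fin k → ℝ => x i₀)
      (g := fun x => x j₀ + δ) (by fun_prop) (by fun_prop))
  have hij : i₀ ≠ j₀ := fun h => by rw [hs, h] at hlt; exact lt_irrefl _ hlt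
  have hFP : P.real (X ⁻¹' F) ≤ 1 / k := by
    rw [hXreal F hFm]
    obtain ⟨s', hs'⟩ := Nat.exists_eq_add_of_lt hpos
    have : NullSingletonClass (sumLaw D s) := by
      rw [hs', zero_add]; exact sumLaw_succ_nullSingletonClass D s'
    exact measureReal_pi_isMax_le _ i₀
  have hJP : (1 / 2) ^ (k + 1) * (1 / 16 / q) ≤ P.real (X ⁻¹' J) := by
    rw [hXreal J hJm]
    obtain ⟨a, ha⟩ := measureReal_sumLaw_two_mul_sqrt_le D hD hpos
    exact exists_le_measureReal_pi_isMax_inter_lt _ hij hδ ha hq0 (by linarith)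
  set G : Set (Fin m → ℝ) := (fun w => w g) ⁻¹' Set.Ici δ with hG
  have hGm : MeasurableSet G := (measurable_pi_apply g) measurableSet_Ici
  have hGP : P.real G = D.real (Set.Ici δ) :=
    congrArg ENNReal.toReal ((measurePreserving_eval (fun _ : Fin m => D) g).measure_preimage
      measurableSet_Ici.nullMeasurableSet)
  have hHP : P.real (X ⁻¹' J ∩ G) = P.real (X ⁻¹' J) * P.real G := by
    have := (indepFun_sum_finset_apply D B hg).measure_inter_preimage_eq_mul J (Set.Ici δ) hJm
      measurableSet_Ici
    simp only [Measure.real, ← ENNReal.toReal_mul]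
    exact congrArg ENNReal.toReal this
  have hdisj : AEDisjoint P (favourite A i₀) (X ⁻¹' J ∩ G) := by
    have h0 : ∀ᵐ w ∂P, w ∉ favourite A i₀ ∩ (X ⁻¹' J ∩ G) := by
      filter_upwards [ae_pi_mem_Icc hD m] with w hw hmem
      have h1 : ∑ l ∈ A j₀, w l ≤ ∑ l ∈ B i₀, w l := hBi ▸ hmem.1 j₀
      have h2 : ∑ l ∈ B i₀, w l < ∑ l ∈ B j₀, w l + δ := hmem.2.1.2
      have h3 : δ ≤ w g := hmem.2.2
      have h4 : ∑ l ∈ insert g (B j₀), w l ≤ ∑ l ∈ A j₀, w l :=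
        Finset.sum_le_sum_of_subset_of_nonneg
          (Finset.insert_subset hgA (hBA j₀)) fun l _ _ => (hw l).1
      rw [Finset.sum_insert hgB] at h4
      linarith
    exact measure_eq_zero_iff_ae_notMem.2 h0
  have hsub : ∀ᵐ w ∂P, w ∈ favourite A i₀ ∪ (X ⁻¹' J ∩ G) → w ∈ X ⁻¹' F := by
    filter_upwards [ae_pi_mem_Icc hD m] with w hw hmem
    rcases hmem with h | h
    · intro j
      have h1 : ∑ l ∈ A j, w l ≤ ∑ l ∈ B i₀, w l := hBi ▸ h j
      exact (Finset.sum_le_sum_of_subset_of_nonneg (hBA j) fun l _ _ => (hw l).1).trans h1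
    · exact h.1.1
  have h1 : P.real (favourite A i₀ ∪ (X ⁻¹' J ∩ G)) ≤ P.real (X ⁻¹' F) :=
    ENNReal.toReal_mono (measure_ne_top _ _) (measure_mono_ae hsub)
  rw [measureReal_union₀ ((hXm hJm).inter hGm).nullMeasurableSet hdisj, hHP, hGP] at h1
  have h2 := mul_le_mul_of_nonneg_right hJP (measureReal_nonneg (μ := D) (s := Set.Ici δ))
  linarith

theorem measureReal_favourite_eq_zero_of_card_eq_zero {D : Measure ℝ} [IsProbabilityMeasure D]
    [NullSingletonClass D] (hD : ∀ᵐ x ∂D, x ∈ Set.Icc (0 : ℝ) 1) {k m : ℕ}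
    (A : Fin k → Finset (Fin m)) {i₀ j₀ : Fin k} (h0 : (A i₀).card = 0)
    (hlt : (A i₀).card < (A j₀).card) :
    (Measure.pi fun _ : Fin m => D).real (favourite A i₀) = 0 := by
  rw [measureReal_eq_zero_iff]
  obtain ⟨g, hg⟩ := Finset.card_pos.1 (h0 ▸ hlt)
  refine measure_eq_zero_iff_ae_notMem.2 ?_
  filter_upwards [ae_pi_mem_Icc hD m, Measure.ae_eval_ne (fun _ : Fin m => D) g 0] with w hw h hmem
  have h1 : ∑ l ∈ A j₀, w l ≤ ∑ l ∈ A i₀, w l := hmem j₀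
  rw [Finset.card_eq_zero.1 h0, Finset.sum_empty] at h1
  have h2 := Finset.single_le_sum (f := w) (fun l _ => (hw l).1) hg
  exact h (le_antisymm (h2.trans h1) (hw g).1)

/-- A smallest bundle of an unbalanced allocation is a favourite one with a probability
that is smaller than `1 / k` by a gap of order `1 / √m`. -/
theorem exists_measureReal_favourite_le {D : Measure ℝ} [IsProbabilityMeasure D]
    [NullSingletonClass D] (hD : ∀ᵐ x ∂D, x ∈ Set.Icc (0 : ℝ) 1) {k : ℕ} (hk : 0 < k) :
    ∃ c > 0, ∀ (m : ℕ) (A : Fin k → Finset (Fin m)) (i₀ j₀ : Fin k), 0 < m →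
      (∀ i j, i ≠ j → Disjoint (A i) (A j)) → (∀ j, (A i₀).card ≤ (A j).card) →
      (A i₀).card < (A j₀).card →
      (Measure.pi fun _ : Fin m => D).real (favourite A i₀) ≤ 1 / k - c / √m := by
  obtain ⟨δ, hδ, hη⟩ := exists_pos_measureReal_Ici_pos D hD
  set η := D.real (Set.Ici δ)
  set c₁ := (1 / 2 : ℝ) ^ (k + 1) * (1 / 16 / (4 / δ + 1)) * η with hc₁
  have hk' : (0 : ℝ) < k := by exact_mod_cast hk
  -- The value 1/k serves an empty smallest bundle, where the gap is all of 1/k; c₁ serves the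
  -- others, through q ≤ (4/δ + 1)√m.
  refine ⟨min (1 / (k : ℝ)) c₁, by positivity, fun m A i₀ j₀ hm hA hmin hlt => ?_⟩
  have hm1 : 1 ≤ √(m : ℝ) := Real.one_le_sqrt.2 (by exact_mod_cast hm)
  rcases Nat.eq_zero_or_pos (A i₀).card with h0 | hpos
  · rw [measureReal_favourite_eq_zero_of_card_eq_zero hD A h0 hlt, sub_nonneg,
      div_le_iff₀ (by positivity)]
    refine (min_le_left _ _).trans (le_mul_of_one_le_right (by positivity) hm1)
  · set q := ⌈4 * √(A i₀).card / δ⌉₊ with hq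
    have hs : √((A i₀).card : ℝ) ≤ √m := Real.sqrt_le_sqrt (by
      exact_mod_cast (Finset.card_le_univ _).trans (by simp))
    have hq0 : 0 < q := Nat.ceil_pos.2 (by positivity)
    have hq0' : (0 : ℝ) < q := by exact_mod_cast hq0
    have hq1 : 4 * √(A i₀).card ≤ q * δ := (div_le_iff₀ hδ).1 (Nat.le_ceil _)
    have hq2 : (q : ℝ) ≤ (4 / δ + 1) * √m := by
      have h1 : (q : ℝ) < 4 * √(A i₀).card / δ + 1 := Nat.ceil_lt_add_one (by positivity)
      have h2 : 4 * √(A i₀).card / δ ≤ 4 / δ * √m := by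
        rw [mul_div_right_comm]; gcongr
      linarith
    refine (measureReal_favourite_le_of_pos hD hδ A hA hmin hlt hpos hq0 hq1).trans ?_
    refine sub_le_sub_left ?_ _
    calc min (1 / (k : ℝ)) c₁ / √m ≤ c₁ / √m := by gcongr; exact min_le_right _ _
      _ = (1 / 2) ^ (k + 1) * (1 / 16 / ((4 / δ + 1) * √m)) * η := by
        rw [hc₁]; field_simp
      _ ≤ _ := by gcongr

/-! ### Concentration and the union bound -/

/-- Hoeffding's inequality for the number of independent samples that fall into a given event. -/
theorem measureReal_pi_le_card_le_exp {Ω : Type*} [MeasurableSpace Ω] (μ : Measure Ω)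
    [IsProbabilityMeasure μ] {E : Set Ω} (hE : MeasurableSet E) {n : ℕ} (hn : 0 < n) {ε : ℝ}
    (hε : 0 ≤ ε) :
    (Measure.pi fun _ : Fin n => μ).real
      {v | n * (μ.real E + ε) ≤ ∑ a, E.indicator (fun _ => (1 : ℝ)) (v a)} ≤
      Real.exp (-(2 * n * ε ^ 2)) := by
  set f : Ω → ℝ := E.indicator fun _ => (1 : ℝ) with hf
  have hfm : Measurable f := measurable_const.indicator hE
  have hind := iIndepFun_pi (μ := fun _ : Fin n => μ) (X := fun _ x => f x - μ.real E)
    fun _ => by fun_prop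
  have hint : ∫ x, f x ∂μ = μ.real E := by rw [hf, integral_indicator_const _ hE]; simp
  -- Values in [0, 1] give variance proxy 1/4, hence the exponent (nε)²/(2·n/4) = 2nε².
  have hsub : HasSubgaussianMGF (fun x => f x - μ.real E) ((‖(1 : ℝ) - 0‖₊ / 2) ^ 2) μ := by
    have := hasSubgaussianMGF_of_mem_Icc (μ := μ) (X := f) (a := 0) (b := 1) hfm.aemeasurable
      (Eventually.of_forall fun x => ⟨Set.indicator_nonneg (fun _ _ => zero_le_one) x,
        Set.indicator_le_self' (fun _ _ => zero_le_one) x⟩)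
    rwa [hint] at this
  have hsub' : ∀ a ∈ (Finset.univ : Finset (Fin n)), HasSubgaussianMGF
      (fun v : Fin n → Ω => f (v a) - μ.real E) ((‖(1 : ℝ) - 0‖₊ / 2) ^ 2)
      (Measure.pi fun _ : Fin n => μ) := fun a _ => by
    refine HasSubgaussianMGF.of_map (X := fun x => f x - μ.real E)
      (Y := fun v : Fin n → Ω => v a) (measurable_pi_apply a).aemeasurable ?_
    rwa [(measurePreserving_eval (fun _ : Fin n => μ) a).map_eq]
  have h := HasSubgaussianMGF.measure_sum_ge_le_of_iIndepFun hind hsub'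
    (ε := n * ε) (by positivity)
  have hn' : (0 : ℝ) < n := by exact_mod_cast hn
  convert h using 2
  · ext v
    simp only [Set.mem_ofPred_eq, Finset.sum_sub_distrib, Finset.sum_const, Finset.card_univ,
      Fintype.card_fin, nsmul_eq_mul]
    constructor <;> intro h <;> linarith
  · simp
    field_simp

theorem exists_min_lt_of_not_dvd {k m : ℕ} (hk : 0 < k) (hm : ¬ k ∣ m) (f : Fin m → Fin k) :
    ∃ i₀ j₀, (∀ j, (Finset.univ.filter (f · = i₀)).card ≤ (Finset.univ.filter (f · = j)).card) ∧
      (Finset.univ.filter (f · = i₀)).card < (Finset.univ.filter (f · = j₀)).card := by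
  have : Nonempty (Fin k) := ⟨⟨0, hk⟩⟩
  obtain ⟨i₀, hi₀⟩ := Finite.exists_min fun j => (Finset.univ.filter (f · = j)).card
  refine ⟨i₀, ?_⟩
  by_contra! h
  obtain ⟨j, hj⟩ : ∃ j, (Finset.univ.filter (f · = i₀)).card <
      (Finset.univ.filter (f · = j)).card := by
    by_contra! h'
    refine hm ⟨(Finset.univ.filter (f · = i₀)).card, ?_⟩
    have h1 := Finset.card_eq_sum_card_fiberwise (f := f) (s := Finset.univ) (t := Finset.univ)
      (fun _ _ => by simp)
    rw [Finset.sum_congr rfl fun j _ => le_antisymm (h' j) (hi₀ j)] at h1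
    simpa using h1
  exact absurd (h j hi₀) (not_le.2 hj)

theorem Outcome.exists_bundle_eq_filter {k n m : ℕ} {s : Fin k → ℕ} (o : Outcome n m s) :
    ∃ f : Fin m → Fin k, ∀ i, o.A i = Finset.univ.filter (f · = i) := by
  choose f hf using o.bundles_cover
  refine ⟨f, fun i => Finset.ext fun g => ?_⟩
  simp only [Finset.mem_filter, Finset.mem_univ, true_and]
  refine ⟨fun hg => ?_, fun hg => hg ▸ hf g⟩
  by_contra hne
  exact Finset.disjoint_left.1 (o.bundles_disjoint _ _ hne) (hf g) hg

theorem Outcome.IsEnvyFree.mem_favourite {k n m : ℕ} {s : Fin k → ℕ} {o : Outcome n m s}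
    {v : Fin n → Fin m → ℝ} (h : o.IsEnvyFree (additiveUtility v)) {i : Fin k} {a : Fin n}
    (ha : a ∈ o.C i) : v a ∈ favourite o.A i := by
  intro j
  obtain ⟨B, -, hB, hle⟩ := h i j a ha
  rw [Finset.card_eq_zero.1 (Nat.le_zero.1 hB), Finset.sdiff_empty] at hle
  exact hle

theorem exists_measureReal_compl_noEnvyFreeOutcome_le {D : Measure ℝ} [IsProbabilityMeasure D]
    [NullSingletonClass D] (hD : ∀ᵐ x ∂D, x ∈ Set.Icc (0 : ℝ) 1) {k : ℕ} (hk : 0 < k) :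
    ∃ c > 0, ∀ n m : ℕ, 0 < n → k ∣ n → ¬ k ∣ m →
      (valueLaw D n m).real (noEnvyFreeOutcome k n m)ᶜ ≤
        k ^ m * Real.exp (-(2 * n * (c / √m) ^ 2)) := by
  obtain ⟨c, hc, hgap⟩ := exists_measureReal_favourite_le hD hk
  refine ⟨c, hc, fun n m hn hkn hkm => ?_⟩
  have hm : 0 < m := Nat.pos_of_ne_zero fun h => hkm (h ▸ dvd_zero k)
  set A : (Fin m → Fin k) → Fin k → Finset (Fin m) := fun f i => Finset.univ.filter (f · = i)
    with hA
  choose i₀ j₀ hmin hlt using exists_min_lt_of_not_dvd hk hkm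
  set μ := Measure.pi fun _ : Fin m => D
  have hp : ∀ f, μ.real (favourite (A f) (i₀ f)) + c / √m ≤ 1 / k := fun f => by
    have := hgap m (A f) (i₀ f) (j₀ f) hm (fun i j hij => Finset.disjoint_left.2 fun g h1 h2 =>
      hij ((Finset.mem_filter.1 h1).2.symm.trans (Finset.mem_filter.1 h2).2)) (hmin f) (hlt f)
    linarith
  set T : (Fin m → Fin k) → Set (Fin n → Fin m → ℝ) := fun f =>
    {v | n * (μ.real (favourite (A f) (i₀ f)) + c / √m) ≤
      ∑ a, (favourite (A f) (i₀ f)).indicator (fun _ => (1 : ℝ)) (v a)} with hT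
  have hsub : (noEnvyFreeOutcome k n m)ᶜ ⊆ ⋃ f, T f := by
    intro v hv
    obtain ⟨o, ho⟩ := not_not.1 hv
    obtain ⟨f, hf⟩ := o.exists_bundle_eq_filter
    refine Set.mem_iUnion.2 ⟨f, ?_⟩
    have hoA : o.A = A f := funext hf
    have hcard : (n : ℝ) * (1 / k) = (o.C (i₀ f)).card := by
      rw [o.groups_card, Nat.cast_div hkn (by positivity)]
      ring
    calc (n : ℝ) * (μ.real (favourite (A f) (i₀ f)) + c / √m) ≤ n * (1 / k) := by
          gcongr; exact hp f
      _ = ∑ a ∈ o.C (i₀ f), (favourite (A f) (i₀ f)).indicator (fun _ => (1 : ℝ)) (v a) := by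
          rw [hcard, Finset.sum_congr rfl fun a ha =>
            Set.indicator_of_mem (hoA ▸ ho.mem_favourite ha) _]
          simp
      _ ≤ _ := Finset.sum_le_sum_of_subset_of_nonneg (Finset.subset_univ _) fun a _ _ =>
          Set.indicator_nonneg (fun _ _ => zero_le_one) _
  have : IsProbabilityMeasure (valueLaw D n m) := by unfold valueLaw; infer_instance
  calc (valueLaw D n m).real (noEnvyFreeOutcome k n m)ᶜ
      ≤ (valueLaw D n m).real (⋃ f, T f) := measureReal_mono hsub
    _ ≤ ∑ f, (valueLaw D n m).real (T f) := measureReal_iUnion_fintype_le _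
    _ ≤ ∑ _f : Fin m → Fin k, Real.exp (-(2 * n * (c / √m) ^ 2)) :=
        Finset.sum_le_sum fun f _ => measureReal_pi_le_card_le_exp μ
          (measurableSet_favourite (A f) (i₀ f)) hn (by positivity)
    _ = _ := by simp

/-! ### Passage to the limit -/

theorem eventually_pow_mul_exp_le {k : ℕ} (hk : 0 < k) {l : Filter ℕ} {m : ℕ → ℕ}
    (hm : (fun n => (m n : ℝ)) =o[l] fun n => √(n : ℝ)) (hm0 : ∀ᶠ n in l, 0 < m n) {c : ℝ}
    (hc : 0 < c) :
    ∀ᶠ n in l, (k : ℝ) ^ m n * Real.exp (-(2 * n * (c / √(m n)) ^ 2)) ≤ Real.exp (-√(n : ℝ)) := by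
  have hL : 0 ≤ Real.log k := Real.log_natCast_nonneg k
  -- The bound 1 gives m log k ≤ √n log k; the other makes the Hoeffding exponent at least (1 + log
  -- k)√n. Their difference leaves √n.
  set ε : ℝ := min 1 (2 * c ^ 2 / (1 + Real.log k)) with hε
  have hε0 : 0 < ε := by positivity
  filter_upwards [hm.bound hε0, hm0] with n hn h0
  rw [Real.norm_natCast, Real.norm_of_nonneg (Real.sqrt_nonneg _)] at hn
  have hm' : (0 : ℝ) < m n := by exact_mod_cast h0
  have hk' : (0 : ℝ) < k := by exact_mod_cast hk
  have hr : 0 ≤ √(n : ℝ) := Real.sqrt_nonneg _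
  have hsq : √(n : ℝ) ^ 2 = n := Real.sq_sqrt n.cast_nonneg
  have h1 : (m n : ℝ) ≤ √n := hn.trans (mul_le_of_le_one_left hr (min_le_left _ _))
  have h2 : (m n : ℝ) * (1 + Real.log k) ≤ 2 * c ^ 2 * √n := by
    have h3 : ε * (1 + Real.log k) ≤ 2 * c ^ 2 :=
      (le_div_iff₀ (by positivity)).1 (min_le_right _ _)
    nlinarith
  have h3 : (1 + Real.log k) * √n ≤ 2 * n * (c / √(m n)) ^ 2 := by
    rw [div_pow, Real.sq_sqrt hm'.le, mul_div_assoc', le_div_iff₀ hm']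
    nlinarith
  rw [← Real.exp_log hk', ← Real.exp_nat_mul, ← Real.exp_add, Real.exp_le_exp]
  nlinarith

theorem theorem5 (k : ℕ) (hk : 2 ≤ k)
    (D : Measure ℝ) [IsProbabilityMeasure D] [NullSingletonClass D] (hD : D.support ⊆ Set.Icc 0 1)
    (m : ℕ → ℕ)
    (hm : (fun n => (m n : ℝ)) =o[atTopMultiples k] fun n => Real.sqrt (n : ℝ))
    (hdvd : ∀ᶠ n in atTopMultiples k, ¬ k ∣ m n) :
    Tendsto (fun n => valueLaw D n (m n) (noEnvyFreeOutcome k n (m n)))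
      (atTopMultiples k) (𝓝 1) := by
  have hk0 : 0 < k := by lia
  have hD' : ∀ᵐ x ∂D, x ∈ Set.Icc (0 : ℝ) 1 := by
    filter_upwards [Measure.support_mem_ae (μ := D)] with x hx using hD hx
  obtain ⟨c, hc, hbound⟩ := exists_measureReal_compl_noEnvyFreeOutcome_le hD' hk0
  have hprob : ∀ n, IsProbabilityMeasure (valueLaw D n (m n)) := fun n => by
    unfold valueLaw; infer_instance
  have hle : atTopMultiples k ≤ atTop := inf_le_left
  have hexp : Tendsto (fun n : ℕ => Real.exp (-√(n : ℝ))) (atTopMultiples k) (𝓝 0) :=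
    (Real.tendsto_exp_neg_atTop_nhds_zero.comp
      (Real.tendsto_sqrt_atTop.comp tendsto_natCast_atTop_atTop)).mono_left hle
  have hlow : Tendsto (fun n : ℕ => 1 - ENNReal.ofReal (Real.exp (-√(n : ℝ))))
      (atTopMultiples k) (𝓝 1) := by
    have := ENNReal.Tendsto.sub (tendsto_const_nhds (x := (1 : ENNReal)))
      (ENNReal.tendsto_ofReal hexp) (Or.inl ENNReal.one_ne_top)
    simpa using this
  refine tendsto_of_tendsto_of_tendsto_of_le_of_le' hlow tendsto_const_nhds ?_
    (Eventually.of_forall fun n => prob_le_one)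
  have hm0 : ∀ᶠ n in atTopMultiples k, 0 < m n := hdvd.mono fun n h =>
    Nat.pos_of_ne_zero fun h0 => h (h0 ▸ dvd_zero k)
  have hmem : ∀ᶠ n in atTopMultiples k, k ∣ n := mem_inf_of_right (mem_principal_self _)
  filter_upwards [eventually_pow_mul_exp_le hk0 hm hm0 hc, hdvd, hmem,
    hle (eventually_gt_atTop 0)] with n hn hkm hkn hn0
  have h1 := ENNReal.ofReal_le_ofReal ((hbound n (m n) hn0 hkn hkm).trans hn)
  rw [ofReal_measureReal] at h1
  rw [tsub_le_iff_right]
  -- Subadditivity suffices, so measurability of the event is not needed.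
  calc (1 : ENNReal) = valueLaw D n (m n) Set.univ := measure_univ.symm
    _ = valueLaw D n (m n) (noEnvyFreeOutcome k n (m n) ∪ (noEnvyFreeOutcome k n (m n))ᶜ) := by
        rw [Set.union_compl_self]
    _ ≤ _ := (measure_union_le _ _).trans (by gcongr)
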